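/- Let $(M,L)$ be a Finsler manifold of dimension $n\ge 3$ ($L$ is positive and smooth on the slit tangent bundle $TM\setminus 0$, positively homogeneous of degree one, with positive definite $g_{ij}=\frac12\,\partial^2L^2/\partial y^i\partial y^j$). Let $\nabla$ be its Cartan connection on the pullback bundle $\pi^{-1}(TM)\to TM\setminus 0$, with horizontal map $\beta$, let $R$ be its h-curvature tensor, let $(\nabla^hT)(X,Y_1,\dots,Y_s)=(\nabla_{\beta X}T)(Y_1,\dots,Y_s)$ be the h-covariant derivative of a tensor field $T$ on $\pi^{-1}(TM)$, and put $\mathbf R(X,Y,Z,W)=g(R(X,Y)Z,W)$. Assume that $(M,L)$ is horizontally integrable, i.e. that its horizontal distribution is completely integrable. By a recurrence form we mean a smooth covariant tensor field on $\pi^{-1}(TM)$ (no symmetry is assumed) which is positively homogeneous of degree zero in $y$ and not identically zero. We say that $(M,L)$ is recurrent with recurrence form $A$ (of order one) if $\nabla^hR=A\otimes R$, and 2-recurrent with recurrence form $\alpha$ (of order two) if $\nabla^h\nabla^hR=\alpha\otimes R$; in both cases $R$ is required to be non-zero, in the sense that it does not vanish identically on any non-empty open subset of $TM\setminus 0$.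 (i) If $(M,L)$ is recurrent with recurrence form $A$, then for all $X,Y,Z,W$: (a) $A(X)R(Y,Z)W+A(Y)R(Z,X)W+A(Z)R(X,Y)W=0$; (b) $\nabla^hA$ is symmetric: $(\nabla^hA)(X,Y)=(\nabla^hA)(Y,X)$; (c) $R(X,Y)\mathbf R=0$, where $R(X,Y)$ acts on $\mathbf R$ as a derivation, i.e. $(R(X,Y)\mathbf R)(Z_1,\dots,Z_4)=-\sum_{b}\mathbf R(\dots,R(X,Y)Z_b,\dots)$. (ii) If $(M,L)$ is 2-recurrent with recurrence form $\alpha$, then $\alpha$ is symmetric, $\alpha(X,Y)=\alpha(Y,X)$, and $R(X,Y)\mathbf R=0$ for all $X,Y$. -/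

import Mathlib

open scoped Manifold ContDiff Topology

noncomputable section

namespace Finsler

/-- The model space `ℝⁿ`. In induced coordinates a point of the tangent bundle is a pair `(x, y)` of
`Coord n × Coord n`: `x` is the position and `y` the fibre coordinate. -/
abbrev Coord (n : ℕ) := EuclideanSpace ℝ (Fin n)

/-- The `i`-th standard basis vector of `ℝⁿ`. -/
abbrev basisVec {n : ℕ} (i : Fin n) : Coord n := EuclideanSpace.single i 1

/-- Components `T^{I}_{J}(x, y)`, in induced coordinates, of a `π`-tensor field of type `(r, s)`, i.e.
of a tensor field on the pullback bundle `π⁻¹(TM)`. The order of the lower indices is the order of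
the arguments of the tensor. -/
abbrev PiTensor (n r s : ℕ) := (Fin r → Fin n) → (Fin s → Fin n) → Coord n × Coord n → ℝ

/-! ### Local Finsler geometry

Throughout, `F (x, y)` is the expression of a Finsler function `L` in induced coordinates. -/

section Coordinates

variable {n : ℕ} (F : Coord n × Coord n → ℝ)

/-- `∂f/∂xⁱ`. -/
def dx (i : Fin n) (f : Coord n × Coord n → ℝ) (z : Coord n × Coord n) : ℝ :=
  fderiv ℝ f z (basisVec i, 0)

/-- `∂f/∂yⁱ`. -/
def dy (i : Fin n) (f : Coord n × Coord n → ℝ) (z : Coord n × Coord n) : ℝ :=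
  fderiv ℝ f z (0, basisVec i)

/-- The Finsler metric `g_{ij} = ½ ∂²F²/∂yⁱ∂yʲ`. -/
def metric (z : Coord n × Coord n) : Matrix (Fin n) (Fin n) ℝ :=
  Matrix.of fun i j => (1 / 2 : ℝ) * dy i (dy j fun w => F w ^ 2) z

/-- The coefficients of the canonical (geodesic) spray,
`Gⁱ = ¼ gⁱˡ (yᵏ ∂²F²/∂xᵏ∂yˡ - ∂F²/∂xˡ)`. -/
def sprayCoeff (i : Fin n) (z : Coord n × Coord n) : ℝ :=
  (1 / 4 : ℝ) * ∑ l, (metric F z)⁻¹ i l *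
    ((∑ k, z.2 k * dx k (dy l fun w => F w ^ 2) z) - dx l (fun w => F w ^ 2) z)

/-- The coefficients `Nⁱ_j = ∂Gⁱ/∂yʲ` of the Cartan nonlinear connection. -/
def nonlinearConn (i j : Fin n) (z : Coord n × Coord n) : ℝ :=
  dy j (sprayCoeff F i) z

/-- The horizontal frame `δ_j = β(∂/∂xʲ) = ∂/∂xʲ - Nᵏ_j ∂/∂yᵏ`, which spans the horizontal space. -/
def hFrame (j : Fin n) (z : Coord n × Coord n) : Coord n × Coord n :=
  (basisVec j, -∑ k, nonlinearConn F k j z • basisVec k)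

/-- The directional derivative `δ_j f`. -/
def hDeriv (j : Fin n) (f : Coord n × Coord n → ℝ) (z : Coord n × Coord n) : ℝ :=
  fderiv ℝ f z (hFrame F j z)

/-- The horizontal coefficients of the Cartan connection, `∇_{δ_k} ∂_j = Γⁱ_{jk} ∂_i`, with
`Γⁱ_{jk} = ½ gⁱˡ (δ_k g_{jl} + δ_j g_{kl} - δ_l g_{jk})`. -/
def hConn (i j k : Fin n) (z : Coord n × Coord n) : ℝ :=
  (1 / 2 : ℝ) * ∑ l, (metric F z)⁻¹ i l *
    (hDeriv F k (fun w => metric F w j l) z + hDeriv F j (fun w => metric F w k l) z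
      - hDeriv F l (fun w => metric F w j k) z)

/-- The vertical coefficients of the Cartan connection (the components of its (h)hv-torsion),
`∇_{∂/∂yᵏ} ∂_j = Cⁱ_{jk} ∂_i`, with `Cⁱ_{jk} = ½ gⁱˡ ∂g_{jl}/∂yᵏ`. -/
def vConn (i j k : Fin n) (z : Coord n × Coord n) : ℝ :=
  (1 / 2 : ℝ) * ∑ l, (metric F z)⁻¹ i l * dy k (fun w => metric F w j l) z

/-- The bracket `[δ_j, δ_k]` is vertical; this is its `∂/∂yᵐ`-component. -/
def hBracket (m j k : Fin n) (z : Coord n × Coord n) : ℝ :=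
  (VectorField.lieBracket ℝ (hFrame F j) (hFrame F k) z).2 m

/-- The component `Rⁱ_{hjk}` of the h-curvature tensor of the Cartan connection:
`R(∂_j, ∂_k)∂_h = Rⁱ_{hjk} ∂_i`. The sign convention for the curvature `𝐊` of a connection is
`𝐊(X, Y)Z = -∇_X ∇_Y Z + ∇_Y ∇_X Z + ∇_{[X, Y]} Z`, and `R(∂_j, ∂_k) = 𝐊(δ_j, δ_k)`. -/
def hCurvComp (i h j k : Fin n) (z : Coord n × Coord n) : ℝ :=
  -(hDeriv F j (hConn F i h k) z + ∑ m, hConn F m h k z * hConn F i m j z)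
    + (hDeriv F k (hConn F i h j) z + ∑ m, hConn F m h j z * hConn F i m k z)
    + ∑ m, hBracket F m j k z * vConn F i h m z

/-- The h-curvature tensor `R` as a `π`-tensor of type `(1, 3)`; the arguments of `R(X, Y)Z` are
taken in the order `X, Y, Z`. -/
def hCurv : PiTensor n 1 3 := fun I J => hCurvComp F (I 0) (J 2) (J 0) (J 1)

/-- The `(0, 4)`-tensor `𝐑(X, Y, Z, W) = g(R(X, Y)Z, W)`. -/
def hCurvLow : PiTensor n 0 4 := fun _ J z =>
  ∑ m, metric F z m (J 3) * hCurvComp F m (J 2) (J 0) (J 1) z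

/-- The h-covariant derivative of a `π`-tensor with respect to the Cartan connection; the direction
of differentiation is the new first argument,
`(∇ʰT)(X, Y₁, …, Y_s) = (∇_{βX} T)(Y₁, …, Y_s)`. -/
def hCov {r s : ℕ} (T : PiTensor n r s) : PiTensor n r (s + 1) := fun I J z =>
  hDeriv F (J 0) (T I (Fin.tail J)) z
    + ∑ a, ∑ m, hConn F (I a) m (J 0) z * T (Function.update I a m) (Fin.tail J) z
    - ∑ b, ∑ m, hConn F m (Fin.tail J b) (J 0) z * T I (Function.update (Fin.tail J) b m) z

/-- The derivation `R(X, Y)` acting on a covariant tensor,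
`(R(X, Y)T)(Z₁, …, Z_s) = -∑_b T(Z₁, …, R(X, Y)Z_b, …, Z_s)`, for `X = ∂_j`, `Y = ∂_k`. -/
def hCurvAct {s : ℕ} (j k : Fin n) (T : PiTensor n 0 s) : PiTensor n 0 s := fun I J z =>
  -∑ b, ∑ m, hCurvComp F m (J b) j k z * T I (Function.update J b m) z

end Coordinates

/-! ### Finsler manifolds -/

section Manifolds

variable {n : ℕ} {M : Type*} [TopologicalSpace M] [ChartedSpace (Coord n) M]

/-- The coordinates `(x, y)`, `y ≠ 0`, of the slit tangent bundle over the chart `e`. -/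
def chartDomain (e : OpenPartialHomeomorph M (Coord n)) : Set (Coord n × Coord n) :=
  {z | z.1 ∈ e.target ∧ z.2 ≠ 0}

/-- The tangent vector at `e.symm x` whose components in the chart `e` are those of `w`. -/
def chartVec (e : OpenPartialHomeomorph M (Coord n)) (x w : Coord n) :
    TangentSpace (𝓡 n) (e.symm x) :=
  mfderiv (𝓡 n) (𝓡 n) e.symm x w

/-- The point of the tangent bundle with induced coordinates `(x, y)`. -/
def chartPoint (e : OpenPartialHomeomorph M (Coord n)) (z : Coord n × Coord n) :
    TangentBundle (𝓡 n) M :=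
  ⟨e.symm z.1, chartVec e z.1 z.2⟩

variable (n M) in
/-- A Finsler function on the manifold `M`: positive and smooth on the slit tangent bundle,
positively homogeneous of degree one, with positive definite `g_{ij} = ½ ∂²L²/∂yⁱ∂yʲ`. -/
structure FinslerMetric where
  /-- The Finsler function `L`. -/
  toFun : TangentBundle (𝓡 n) M → ℝ
  pos : ∀ (p : M) (v : TangentSpace (𝓡 n) p), v ≠ 0 → 0 < toFun ⟨p, v⟩
  homogeneous : ∀ (p : M) (v : TangentSpace (𝓡 n) p) (c : ℝ), 0 < c →
    toFun ⟨p, c • v⟩ = c * toFun ⟨p, v⟩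
  smooth : ∀ e ∈ atlas (Coord n) M,
    ContDiffOn ℝ ∞ (fun z => toFun (chartPoint e z)) (chartDomain e)
  posDef : ∀ e ∈ atlas (Coord n) M, ∀ z ∈ chartDomain e,
    (metric (fun w => toFun (chartPoint e w)) z).PosDef

variable (n M) in
/-- A scalar `k`-form along the tangent bundle, i.e. a covariant `π`-tensor with `k` arguments (no
symmetry is assumed). -/
abbrev ScalarForm (k : ℕ) :=
  (u : TangentBundle (𝓡 n) M) →
    MultilinearMap ℝ (fun _ : Fin k => TangentSpace (𝓡 n) u.proj) ℝ

/-- The components of a scalar form in the chart `e`. -/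
def ScalarForm.inChart {k : ℕ} (A : ScalarForm n M k) (e : OpenPartialHomeomorph M (Coord n)) :
    PiTensor n 0 k := fun _ J z =>
  A (chartPoint e z) fun b => chartVec e z.1 (basisVec (J b))

/-- A scalar form is admissible as a recurrence form if it is smooth on the slit tangent bundle,
positively homogeneous of degree zero in `y`, and not identically zero there. -/
structure ScalarForm.IsRecurrenceForm {k : ℕ} (A : ScalarForm n M k) : Prop where
  smooth : ∀ e ∈ atlas (Coord n) M, ∀ I J, ContDiffOn ℝ ∞ (A.inChart e I J) (chartDomain e)
  homogeneous : ∀ (p : M) (v : TangentSpace (𝓡 n) p), v ≠ 0 → ∀ c : ℝ, 0 < c →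
    ∀ X : Fin k → TangentSpace (𝓡 n) p, A ⟨p, c • v⟩ X = A ⟨p, v⟩ X
  ne_zero : ∃ (p : M) (v : TangentSpace (𝓡 n) p), v ≠ 0 ∧ A ⟨p, v⟩ ≠ 0

namespace FinslerMetric

variable (L : FinslerMetric n M)

/-- The Finsler function in the induced coordinates of the chart `e`. -/
def inChart (e : OpenPartialHomeomorph M (Coord n)) : Coord n × Coord n → ℝ :=
  fun z => L.toFun (chartPoint e z)

/-- The horizontal distribution is completely integrable, i.e. involutive. -/
def HorizontallyIntegrable : Prop :=
  ∀ e ∈ atlas (Coord n) M, ∀ z ∈ chartDomain e, ∀ j k : Fin n,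
    VectorField.lieBracket ℝ (hFrame (L.inChart e) j) (hFrame (L.inChart e) k) z ∈
      Submodule.span ℝ (Set.range fun i => hFrame (L.inChart e) i z)

/-- The h-curvature tensor is non-zero: it does not vanish identically on any non-empty open subset
of the slit tangent bundle. -/
def CurvatureNonzero : Prop :=
  ∀ e ∈ atlas (Coord n) M,
    chartDomain e ⊆ closure {z ∈ chartDomain e | ∃ I J, hCurv (L.inChart e) I J z ≠ 0}

/-- Recurrence with recurrence form `A`: the h-curvature `R` is non-zero and `∇ʰR = A ⊗ R`. -/
structure IsRecurrent (A : ScalarForm n M 1) : Prop where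
  curvature_nonzero : L.CurvatureNonzero
  form : A.IsRecurrenceForm
  recurrence : ∀ e ∈ atlas (Coord n) M, ∀ z ∈ chartDomain e, ∀ i a b c d : Fin n,
    hCov (L.inChart e) (hCurv (L.inChart e)) ![i] ![a, b, c, d] z =
      A.inChart e ![] ![a] z * hCurv (L.inChart e) ![i] ![b, c, d] z

/-- 2-recurrence with recurrence form `α`: the h-curvature `R` is non-zero and
`∇ʰ∇ʰR = α ⊗ R`. -/
structure IsTwoRecurrent (α : ScalarForm n M 2) : Prop where
  curvature_nonzero : L.CurvatureNonzero
  form : α.IsRecurrenceForm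
  recurrence : ∀ e ∈ atlas (Coord n) M, ∀ z ∈ chartDomain e, ∀ i a b c d f : Fin n,
    hCov (L.inChart e) (hCov (L.inChart e) (hCurv (L.inChart e))) ![i] ![a, b, c, d, f] z =
      α.inChart e ![] ![a, b] z * hCurv (L.inChart e) ![i] ![c, d, f] z

/-- `R(X, Y)𝐑 = 0` for all `X`, `Y`. -/
def CurvatureSemisymmetric : Prop :=
  ∀ e ∈ atlas (Coord n) M, ∀ z ∈ chartDomain e, ∀ (j k : Fin n) (J : Fin 4 → Fin n),
    hCurvAct (L.inChart e) j k (hCurvLow (L.inChart e)) ![] J z = 0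

end FinslerMetric

end Manifolds

end Finsler

end

/-! The bracket `[δ_j, δ_k]` is always vertical, so complete integrability of the horizontal
distribution forces it to vanish: the operators `δ_j` commute and the vertical coefficients drop out
of the h-curvature. What remains is formally Riemannian. The coefficients `Γ` are symmetric and
metric, so `𝐑` is skew in each pair of arguments and satisfies the first Bianchi identity, hence is
symmetric under exchange of the pairs; the second Bianchi identity and the Ricci identity hold
without torsion terms.

Part (i)(a) is the second Bianchi identity with `∇ʰR = A ⊗ R` inserted. For the rest, recurrence
gives `∇ʰ∇ʰR = (∇ʰA + A ⊗ A) ⊗ R`, so both cases have the form `∇ʰ∇ʰR = α ⊗ R`. Let `t(X, Y) = α(X,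
Y) - α(Y, X)`. The Ricci identity, after lowering an index, reads `t(X, Y) 𝐑 = -R(X, Y)𝐑`. By
Walker's identity (`hCurvAct_cyclic`) the cyclic sum of the right-hand side over three pairs of
arguments is zero. Regarding `𝐑` as a symmetric array indexed by pairs, Walker's lemma
(`eq_zero_of_cyclic_mul`) then gives `t = 0` wherever `R ≠ 0`, and this set is dense, so `t = 0`
everywhere by continuity. Finally `R(X, Y)𝐑 = 0` holds where `R ≠ 0` because `t = 0` there, and
trivially where `R = 0`. -/

noncomputable section

namespace Finsler

/-! ### Smoothness of the Cartan connection, commuting horizontal derivatives and metric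
compatibility -/

section Regularity

variable {n : ℕ} {F : Coord n × Coord n → ℝ} {U : Set (Coord n × Coord n)}

/-- `F` is, on the open set `U`, the coordinate expression of a Finsler function whose horizontal
frame fields commute. -/
structure IsIntegrableOn (F : Coord n × Coord n → ℝ) (U : Set (Coord n × Coord n)) : Prop where
  isOpen : IsOpen U
  smooth : ContDiffOn ℝ ∞ F U
  posDef : ∀ z ∈ U, (metric F z).PosDef
  lieBracket_eq_zero : ∀ z ∈ U, ∀ j k, VectorField.lieBracket ℝ (hFrame F j) (hFrame F k) z = 0

theorem contDiffOn_fderiv_apply (hU : IsOpen U) {f : Coord n × Coord n → ℝ}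
    (hf : ContDiffOn ℝ ∞ f U) {V : Coord n × Coord n → Coord n × Coord n}
    (hV : ContDiffOn ℝ ∞ V U) : ContDiffOn ℝ ∞ (fun z => fderiv ℝ f z (V z)) U :=
  (hf.fderiv_of_isOpen hU (by simp)).clm_apply hV

theorem contDiffOn_dx (hU : IsOpen U) {f : Coord n × Coord n → ℝ} (hf : ContDiffOn ℝ ∞ f U)
    (i : Fin n) : ContDiffOn ℝ ∞ (dx i f) U :=
  contDiffOn_fderiv_apply hU hf contDiffOn_const

theorem contDiffOn_dy (hU : IsOpen U) {f : Coord n × Coord n → ℝ} (hf : ContDiffOn ℝ ∞ f U)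
    (i : Fin n) : ContDiffOn ℝ ∞ (dy i f) U :=
  contDiffOn_fderiv_apply hU hf contDiffOn_const

theorem contDiffOn_det {m : Type*} [Fintype m] [DecidableEq m]
    {B : Coord n × Coord n → Matrix m m ℝ} (hB : ∀ i j, ContDiffOn ℝ ∞ (fun z => B z i j) U) :
    ContDiffOn ℝ ∞ (fun z => (B z).det) U := by
  simp only [Matrix.det_apply]
  refine ContDiffOn.sum fun σ _ => ?_
  simp only [Units.smul_def, zsmul_eq_mul]
  exact contDiffOn_const.mul (contDiffOn_prod fun i _ => hB _ _)

/-- Cramer's rule: the entries of the adjugate are determinants with one row replaced by a constant.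
-/
theorem contDiffOn_matrix_inv {m : Type*} [Fintype m] [DecidableEq m]
    {B : Coord n × Coord n → Matrix m m ℝ} (hB : ∀ i j, ContDiffOn ℝ ∞ (fun z => B z i j) U)
    (hdet : ∀ z ∈ U, (B z).det ≠ 0) (i j : m) : ContDiffOn ℝ ∞ (fun z => (B z)⁻¹ i j) U := by
  simp only [Matrix.inv_def, Ring.inverse_eq_inv', Matrix.smul_apply, Matrix.adjugate_apply,
    smul_eq_mul]
  refine ((contDiffOn_det hB).inv hdet).mul (contDiffOn_det fun k l => ?_)
  by_cases hk : k = j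
  · subst hk; simpa using contDiffOn_const
  · simpa [Matrix.updateRow_ne hk] using hB k l

theorem contDiffOn_matrix_mul {m : Type*} [Fintype m] {B C : Coord n × Coord n → Matrix m m ℝ}
    (hB : ∀ i j, ContDiffOn ℝ ∞ (fun z => B z i j) U)
    (hC : ∀ i j, ContDiffOn ℝ ∞ (fun z => C z i j) U) (i j : m) :
    ContDiffOn ℝ ∞ (fun z => (B z * C z) i j) U := by
  simp only [Matrix.mul_apply]
  exact ContDiffOn.sum fun k _ => (hB i k).mul (hC k j)

namespace IsIntegrableOn

variable (h : IsIntegrableOn F U)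
include h

theorem contDiffOn_metric (i j : Fin n) : ContDiffOn ℝ ∞ (fun z => metric F z i j) U :=
  contDiffOn_const.mul (contDiffOn_dy h.isOpen (contDiffOn_dy h.isOpen (h.smooth.pow 2) j) i)

theorem det_metric_ne_zero {z : Coord n × Coord n} (hz : z ∈ U) : (metric F z).det ≠ 0 :=
  (h.posDef z hz).det_pos.ne'

theorem contDiffOn_metric_inv (i j : Fin n) : ContDiffOn ℝ ∞ (fun z => (metric F z)⁻¹ i j) U :=
  contDiffOn_matrix_inv h.contDiffOn_metric (fun _ => h.det_metric_ne_zero) i j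

theorem contDiffOn_sprayCoeff (i : Fin n) : ContDiffOn ℝ ∞ (sprayCoeff F i) U := by
  refine contDiffOn_const.mul (ContDiffOn.sum fun l _ => (h.contDiffOn_metric_inv i l).mul ?_)
  refine ContDiffOn.sub (ContDiffOn.sum fun k _ => ContDiffOn.mul ?_ ?_) ?_
  · exact ((EuclideanSpace.proj k : Coord n →L[ℝ] ℝ).contDiff.comp contDiff_snd).contDiffOn
  · exact contDiffOn_dx h.isOpen (contDiffOn_dy h.isOpen (h.smooth.pow 2) l) k
  · exact contDiffOn_dx h.isOpen (h.smooth.pow 2) l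

theorem contDiffOn_hFrame (j : Fin n) : ContDiffOn ℝ ∞ (hFrame F j) U :=
  contDiffOn_const.prodMk (ContDiffOn.neg (ContDiffOn.sum fun k _ =>
    (contDiffOn_dy h.isOpen (h.contDiffOn_sprayCoeff k) j).smul contDiffOn_const))

theorem contDiffOn_hDeriv (j : Fin n) {f : Coord n × Coord n → ℝ} (hf : ContDiffOn ℝ ∞ f U) :
    ContDiffOn ℝ ∞ (hDeriv F j f) U :=
  contDiffOn_fderiv_apply h.isOpen hf (h.contDiffOn_hFrame j)

theorem contDiffOn_hConn (i j k : Fin n) : ContDiffOn ℝ ∞ (hConn F i j k) U :=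
  contDiffOn_const.mul (ContDiffOn.sum fun l _ => (h.contDiffOn_metric_inv i l).mul
    (((h.contDiffOn_hDeriv k (h.contDiffOn_metric j l)).add
      (h.contDiffOn_hDeriv j (h.contDiffOn_metric k l))).sub
      (h.contDiffOn_hDeriv l (h.contDiffOn_metric j k))))

/-- The second-order parts agree by symmetry of the second derivative; the first-order parts differ
by `df([δ_j, δ_k])`, which is zero. Torsion terms disappear from the Bianchi and Ricci identities
for this reason. -/
theorem hDeriv_comm {f : Coord n × Coord n → ℝ} (hf : ContDiffOn ℝ ∞ f U)
    {z : Coord n × Coord n} (hz : z ∈ U) (j k : Fin n) :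
    hDeriv F j (hDeriv F k f) z = hDeriv F k (hDeriv F j f) z := by
  have hU := h.isOpen.mem_nhds hz
  have key : ∀ j k : Fin n, hDeriv F j (hDeriv F k f) z =
      fderiv ℝ (fderiv ℝ f) z (hFrame F j z) (hFrame F k z) +
        fderiv ℝ f z (fderiv ℝ (hFrame F k) z (hFrame F j z)) := by
    intro j k
    have h1 : DifferentiableAt ℝ (fderiv ℝ f) z :=
      ((hf.fderiv_of_isOpen (m := ∞) h.isOpen (by simp)).contDiffAt hU).differentiableAt (by simp)
    have h2 : DifferentiableAt ℝ (hFrame F k) z :=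
      ((h.contDiffOn_hFrame k).contDiffAt hU).differentiableAt (by simp)
    have h3 : hDeriv F k f = fun w => fderiv ℝ f w (hFrame F k w) := rfl
    rw [hDeriv, h3, fderiv_clm_apply h1 h2]
    simp [add_comm]
  have hs : IsSymmSndFDerivAt ℝ f z := (hf.contDiffAt hU).isSymmSndFDerivAt
    (by simpa using WithTop.coe_le_coe.2 (le_top : (2 : ℕ∞) ≤ ⊤))
  have hb := congrArg (fderiv ℝ f z) (h.lieBracket_eq_zero z hz j k)
  rw [VectorField.lieBracket, map_sub, map_zero, sub_eq_zero] at hb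
  rw [key, key, hs.eq, hb]

theorem metric_symm {z : Coord n × Coord n} (hz : z ∈ U) (i j : Fin n) :
    metric F z i j = metric F z j i := by
  simpa using (h.posDef z hz).isHermitian.apply j i

theorem metric_inv_symm {z : Coord n × Coord n} (hz : z ∈ U) (i j : Fin n) :
    (metric F z)⁻¹ i j = (metric F z)⁻¹ j i := by
  simpa using (h.posDef z hz).isHermitian.inv.apply j i

theorem metric_mul_inv {z : Coord n × Coord n} (hz : z ∈ U) :
    metric F z * (metric F z)⁻¹ = 1 :=
  Matrix.mul_nonsing_inv _ (isUnit_iff_ne_zero.2 (h.det_metric_ne_zero hz))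

theorem hDeriv_congr {f f' : Coord n × Coord n → ℝ} (hff : Set.EqOn f f' U)
    {z : Coord n × Coord n} (hz : z ∈ U) (j : Fin n) : hDeriv F j f z = hDeriv F j f' z := by
  rw [hDeriv, hDeriv, (hff.eventuallyEq_of_mem (h.isOpen.mem_nhds hz)).fderiv_eq]

theorem differentiableAt {f : Coord n × Coord n → ℝ} (hf : ContDiffOn ℝ ∞ f U)
    {z : Coord n × Coord n} (hz : z ∈ U) : DifferentiableAt ℝ f z :=
  (hf.contDiffAt (h.isOpen.mem_nhds hz)).differentiableAt (by simp)

theorem hConn_symm {z : Coord n × Coord n} (hz : z ∈ U) (i j k : Fin n) :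
    hConn F i j k z = hConn F i k j z := by
  unfold hConn
  congr 1
  refine Finset.sum_congr rfl fun l _ => ?_
  rw [h.hDeriv_congr (fun w hw => h.metric_symm hw j k) hz l]
  ring

/-- This is `∇ʰg = 0`. Lowering the upper index of `Γ` cancels `g⁻¹`; in the sum of the two
Koszul-type expressions every derivative cancels except `δ_k g_{ij}`. -/
theorem hDeriv_metric {z : Coord n × Coord n} (hz : z ∈ U) (i j k : Fin n) :
    hDeriv F k (fun w => metric F w i j) z =
      ∑ m, metric F z i m * hConn F m j k z + ∑ m, metric F z j m * hConn F m i k z := by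
  have lower : ∀ a b c : Fin n, ∑ m, metric F z a m * hConn F m b c z =
      1 / 2 * (hDeriv F c (fun w => metric F w b a) z + hDeriv F b (fun w => metric F w c a) z
        - hDeriv F a (fun w => metric F w b c) z) := by
    intro a b c
    have h1 : ∀ l, ∑ m, metric F z a m * (metric F z)⁻¹ m l = if a = l then 1 else 0 := by
      intro l
      rw [← Matrix.mul_apply, h.metric_mul_inv hz, Matrix.one_apply]
    simp only [hConn, Finset.mul_sum]
    rw [Finset.sum_comm]
    have h2 : ∀ l, ∑ m, metric F z a m * (1 / 2 * ((metric F z)⁻¹ m l *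
        (hDeriv F c (fun w => metric F w b l) z + hDeriv F b (fun w => metric F w c l) z
          - hDeriv F l (fun w => metric F w b c) z))) = (if a = l then 1 else 0) *
        (1 / 2 * (hDeriv F c (fun w => metric F w b l) z + hDeriv F b (fun w => metric F w c l) z
          - hDeriv F l (fun w => metric F w b c) z)) := by
      intro l
      rw [← h1, Finset.sum_mul]
      exact Finset.sum_congr rfl fun m _ => by ring
    rw [Finset.sum_congr rfl fun l _ => h2 l]
    simp
  rw [lower, lower, h.hDeriv_congr (fun w hw => h.metric_symm hw j i) hz k,
    h.hDeriv_congr (fun w hw => h.metric_symm hw k i) hz j,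
    h.hDeriv_congr (fun w hw => h.metric_symm hw k j) hz i]
  rw [h.hDeriv_congr (fun w hw => h.metric_symm hw i k) hz j,
    h.hDeriv_congr (fun w hw => h.metric_symm hw j k) hz i]
  ring

end IsIntegrableOn

theorem hDeriv_add {f f' : Coord n × Coord n → ℝ} {z : Coord n × Coord n}
    (hf : DifferentiableAt ℝ f z) (hf' : DifferentiableAt ℝ f' z) (j : Fin n) :
    hDeriv F j (fun w => f w + f' w) z = hDeriv F j f z + hDeriv F j f' z := by
  simp [hDeriv, fderiv_fun_add hf hf']

theorem hDeriv_sub {f f' : Coord n × Coord n → ℝ} {z : Coord n × Coord n}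
    (hf : DifferentiableAt ℝ f z) (hf' : DifferentiableAt ℝ f' z) (j : Fin n) :
    hDeriv F j (fun w => f w - f' w) z = hDeriv F j f z - hDeriv F j f' z := by
  simp [hDeriv, fderiv_fun_sub hf hf']

theorem hDeriv_mul {f f' : Coord n × Coord n → ℝ} {z : Coord n × Coord n}
    (hf : DifferentiableAt ℝ f z) (hf' : DifferentiableAt ℝ f' z) (j : Fin n) :
    hDeriv F j (fun w => f w * f' w) z = hDeriv F j f z * f' z + f z * hDeriv F j f' z := by
  simp [hDeriv, fderiv_fun_mul hf hf']
  ring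

theorem hDeriv_sum_mul {f f' : Fin n → Coord n × Coord n → ℝ} {z : Coord n × Coord n}
    (hf : ∀ m, DifferentiableAt ℝ (f m) z) (hf' : ∀ m, DifferentiableAt ℝ (f' m) z) (j : Fin n) :
    hDeriv F j (fun w => ∑ m, f m w * f' m w) z =
      ∑ m, hDeriv F j (f m) z * f' m z + ∑ m, f m z * hDeriv F j (f' m) z := by
  rw [← Finset.sum_add_distrib, hDeriv, fderiv_fun_sum (A := fun m w => f m w * f' m w)
    fun m _ => (hf m).mul (hf' m)]
  simp only [_root_.sum_apply]
  exact Finset.sum_congr rfl fun m _ => hDeriv_mul (hf m) (hf' m) j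

end Regularity

/-! ### Slotwise action of matrices on tensors of type `(1, 3)` -/

section SlotAction

variable {n : ℕ}

/-- Arrays of real numbers with four indices. -/
abbrev Array₄ (n : ℕ) := Fin n → Fin n → Fin n → Fin n → ℝ

/-- The action of a matrix on the first (contravariant) index. -/
def slot₁ (B : Matrix (Fin n) (Fin n) ℝ) (T : Array₄ n) : Array₄ n :=
  fun i c d f => ∑ m, B i m * T m c d f

/-- The action of a matrix on the second (covariant) index. -/
def slot₂ (B : Matrix (Fin n) (Fin n) ℝ) (T : Array₄ n) : Array₄ n :=
  fun i c d f => ∑ m, B m c * T i m d f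

/-- The action of a matrix on the third (covariant) index. -/
def slot₃ (B : Matrix (Fin n) (Fin n) ℝ) (T : Array₄ n) : Array₄ n :=
  fun i c d f => ∑ m, B m d * T i c m f

/-- The action of a matrix on the fourth (covariant) index. -/
def slot₄ (B : Matrix (Fin n) (Fin n) ℝ) (T : Array₄ n) : Array₄ n :=
  fun i c d f => ∑ m, B m f * T i c d m

/-- The derivation action of a matrix on tensors of type `(1, 3)`. -/
def slotAction (B : Matrix (Fin n) (Fin n) ℝ) (T : Array₄ n) : Array₄ n :=
  slot₁ B T - slot₂ B T - slot₃ B T - slot₄ B T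

variable (A B : Matrix (Fin n) (Fin n) ℝ) (S T : Array₄ n)

theorem slot₁_sub : slot₁ A (S - T) = slot₁ A S - slot₁ A T := by
  funext i c d f; simp [slot₁, mul_sub]

theorem slot₂_sub : slot₂ A (S - T) = slot₂ A S - slot₂ A T := by
  funext i c d f; simp [slot₂, mul_sub]

theorem slot₃_sub : slot₃ A (S - T) = slot₃ A S - slot₃ A T := by
  funext i c d f; simp [slot₃, mul_sub]

theorem slot₄_sub : slot₄ A (S - T) = slot₄ A S - slot₄ A T := by
  funext i c d f; simp [slot₄, mul_sub]

/-- Actions on different indices commute. This lemma and its five analogues orient every mixed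
product the same way, so that mixed products cancel in a commutator. -/
theorem slot₂_slot₁ : slot₂ A (slot₁ B T) = slot₁ B (slot₂ A T) := by
  funext i c d f
  simp only [slot₁, slot₂, Finset.mul_sum, mul_left_comm (B _ _)]
  exact Finset.sum_comm

theorem slot₃_slot₁ : slot₃ A (slot₁ B T) = slot₁ B (slot₃ A T) := by
  funext i c d f
  simp only [slot₁, slot₃, Finset.mul_sum, mul_left_comm (B _ _)]
  exact Finset.sum_comm

theorem slot₄_slot₁ : slot₄ A (slot₁ B T) = slot₁ B (slot₄ A T) := by
  funext i c d f
  simp only [slot₁, slot₄, Finset.mul_sum, mul_left_comm (B _ _)]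
  exact Finset.sum_comm

theorem slot₃_slot₂ : slot₃ A (slot₂ B T) = slot₂ B (slot₃ A T) := by
  funext i c d f
  simp only [slot₂, slot₃, Finset.mul_sum, mul_left_comm (B _ _)]
  exact Finset.sum_comm

theorem slot₄_slot₂ : slot₄ A (slot₂ B T) = slot₂ B (slot₄ A T) := by
  funext i c d f
  simp only [slot₂, slot₄, Finset.mul_sum, mul_left_comm (B _ _)]
  exact Finset.sum_comm

theorem slot₄_slot₃ : slot₄ A (slot₃ B T) = slot₃ B (slot₄ A T) := by
  funext i c d f
  simp only [slot₃, slot₄, Finset.mul_sum, mul_left_comm (B _ _)]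
  exact Finset.sum_comm

theorem slot₁_mul : slot₁ (A * B) T = slot₁ A (slot₁ B T) := by
  funext i c d f
  simp only [slot₁, Matrix.mul_apply, Finset.mul_sum, Finset.sum_mul, mul_assoc]
  exact Finset.sum_comm

/-- On a covariant index the matrix acts by its transpose, which reverses products; the minus sign
in `slotAction` compensates. -/
theorem slot₂_mul : slot₂ (A * B) T = slot₂ B (slot₂ A T) := by
  funext i c d f
  simp only [slot₂, Matrix.mul_apply, Finset.mul_sum, Finset.sum_mul, mul_assoc,
    mul_left_comm (B _ _)]
  exact Finset.sum_comm

theorem slot₃_mul : slot₃ (A * B) T = slot₃ B (slot₃ A T) := by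
  funext i c d f
  simp only [slot₃, Matrix.mul_apply, Finset.mul_sum, Finset.sum_mul, mul_assoc,
    mul_left_comm (B _ _)]
  exact Finset.sum_comm

theorem slot₄_mul : slot₄ (A * B) T = slot₄ B (slot₄ A T) := by
  funext i c d f
  simp only [slot₄, Matrix.mul_apply, Finset.mul_sum, Finset.sum_mul, mul_assoc,
    mul_left_comm (B _ _)]
  exact Finset.sum_comm

theorem slotAction_sub_left : slotAction (A - B) T = slotAction A T - slotAction B T := by
  funext i c d f
  simp only [slotAction, slot₁, slot₂, slot₃, slot₄, Pi.sub_apply,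
    Matrix.sub_apply, sub_mul, Finset.sum_sub_distrib]
  ring

theorem slotAction_add_right : slotAction A (S + T) = slotAction A S + slotAction A T := by
  funext i c d f
  simp only [slotAction, slot₁, slot₂, slot₃, slot₄, Pi.sub_apply, Pi.add_apply,
    mul_add, Finset.sum_add_distrib]
  ring

/-- The derivation action is a representation of the Lie algebra of matrices. This produces the
`[Γ_a, Γ_b]` part of the curvature in the Ricci identity. -/
theorem slotAction_commutator :
    slotAction (A * B - B * A) T =
      slotAction A (slotAction B T) - slotAction B (slotAction A T) := by
  rw [slotAction_sub_left]
  simp only [slotAction, slot₁_sub, slot₂_sub, slot₃_sub, slot₄_sub, slot₁_mul, slot₂_mul,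
    slot₃_mul, slot₄_mul, slot₂_slot₁, slot₃_slot₁, slot₄_slot₁, slot₃_slot₂, slot₄_slot₂,
    slot₄_slot₃]
  abel

end SlotAction

/-! ### Curvature identities -/

section Curvature

variable {n : ℕ} {F : Coord n × Coord n → ℝ} {U : Set (Coord n × Coord n)}

variable (F) in
/-- The connection matrix `Γ_a` of the Cartan connection in the horizontal direction `δ_a`. -/
def connMatrix (a : Fin n) (z : Coord n × Coord n) : Matrix (Fin n) (Fin n) ℝ :=
  Matrix.of fun i h => hConn F i h a z

variable (F) in
/-- The entrywise horizontal derivative of a matrix of functions. -/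
def hDerivMatrix (a : Fin n) (B : Coord n × Coord n → Matrix (Fin n) (Fin n) ℝ)
    (z : Coord n × Coord n) : Matrix (Fin n) (Fin n) ℝ :=
  Matrix.of fun i j => hDeriv F a (fun w => B w i j) z

variable (F) in
/-- The matrix of the endomorphism `R(∂_j, ∂_k)`. -/
def curvMatrix (j k : Fin n) (z : Coord n × Coord n) : Matrix (Fin n) (Fin n) ℝ :=
  Matrix.of fun i h => hCurvComp F i h j k z

theorem hDerivMatrix_add {B C : Coord n × Coord n → Matrix (Fin n) (Fin n) ℝ}
    {z : Coord n × Coord n} (hB : ∀ i j, DifferentiableAt ℝ (fun w => B w i j) z)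
    (hC : ∀ i j, DifferentiableAt ℝ (fun w => C w i j) z) (a : Fin n) :
    hDerivMatrix F a (fun w => B w + C w) z = hDerivMatrix F a B z + hDerivMatrix F a C z := by
  ext i j
  exact hDeriv_add (hB i j) (hC i j) a

theorem hDerivMatrix_sub {B C : Coord n × Coord n → Matrix (Fin n) (Fin n) ℝ}
    {z : Coord n × Coord n} (hB : ∀ i j, DifferentiableAt ℝ (fun w => B w i j) z)
    (hC : ∀ i j, DifferentiableAt ℝ (fun w => C w i j) z) (a : Fin n) :
    hDerivMatrix F a (fun w => B w - C w) z = hDerivMatrix F a B z - hDerivMatrix F a C z := by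
  ext i j
  exact hDeriv_sub (hB i j) (hC i j) a

theorem hDerivMatrix_mul {B C : Coord n × Coord n → Matrix (Fin n) (Fin n) ℝ}
    {z : Coord n × Coord n} (hB : ∀ i j, DifferentiableAt ℝ (fun w => B w i j) z)
    (hC : ∀ i j, DifferentiableAt ℝ (fun w => C w i j) z) (a : Fin n) :
    hDerivMatrix F a (fun w => B w * C w) z =
      hDerivMatrix F a B z * C z + B z * hDerivMatrix F a C z := by
  ext i j
  simp only [Matrix.add_apply, Matrix.mul_apply, hDerivMatrix, Matrix.of_apply]
  exact hDeriv_sum_mul (fun m => hB i m) (fun m => hC m j) a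

theorem hDerivMatrix_transpose (B : Coord n × Coord n → Matrix (Fin n) (Fin n) ℝ) (a : Fin n)
    (z : Coord n × Coord n) :
    hDerivMatrix F a (fun w => (B w).transpose) z = (hDerivMatrix F a B z).transpose := rfl

namespace IsIntegrableOn

variable (h : IsIntegrableOn F U)
include h

theorem hDerivMatrix_congr {B C : Coord n × Coord n → Matrix (Fin n) (Fin n) ℝ}
    (hBC : Set.EqOn B C U) {z : Coord n × Coord n} (hz : z ∈ U) (a : Fin n) :
    hDerivMatrix F a B z = hDerivMatrix F a C z := by
  ext i j
  exact h.hDeriv_congr (fun w hw => congrFun₂ (hBC hw) i j) hz a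

/-- With zero bracket the `vConn` term vanishes and only the curvature of a matrix-valued connection
form is left. The signs follow the convention of `hCurvComp`, opposite to `dΓ + Γ ∧ Γ`. -/
theorem curvMatrix_eq {z : Coord n × Coord n} (hz : z ∈ U) (j k : Fin n) :
    curvMatrix F j k z =
      (hDerivMatrix F k (connMatrix F j) z - hDerivMatrix F j (connMatrix F k) z) +
        (connMatrix F k z * connMatrix F j z - connMatrix F j z * connMatrix F k z) := by
  ext i l
  simp only [curvMatrix, hCurvComp, hBracket, h.lieBracket_eq_zero z hz j k, hDerivMatrix,
    connMatrix, Matrix.add_apply, Matrix.sub_apply, Matrix.mul_apply, Matrix.of_apply,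
    mul_comm (hConn F i _ _ z)]
  simp
  ring

theorem contDiffOn_curv (i l j k : Fin n) : ContDiffOn ℝ ∞ (hCurvComp F i l j k) U := by
  have h1 : ContDiffOn ℝ ∞ (fun z => ((hDerivMatrix F k (connMatrix F j) z
      - hDerivMatrix F j (connMatrix F k) z) + (connMatrix F k z * connMatrix F j z
        - connMatrix F j z * connMatrix F k z)) i l) U := by
    simp only [hDerivMatrix, connMatrix, Matrix.add_apply, Matrix.sub_apply, Matrix.mul_apply,
      Matrix.of_apply]
    refine ContDiffOn.add (ContDiffOn.sub ?_ ?_) (ContDiffOn.sub ?_ ?_)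
    · exact h.contDiffOn_hDeriv k (h.contDiffOn_hConn i l j)
    · exact h.contDiffOn_hDeriv j (h.contDiffOn_hConn i l k)
    · exact ContDiffOn.sum fun m _ => (h.contDiffOn_hConn _ _ _).mul (h.contDiffOn_hConn _ _ _)
    · exact ContDiffOn.sum fun m _ => (h.contDiffOn_hConn _ _ _).mul (h.contDiffOn_hConn _ _ _)
  exact h1.congr fun z hz => congrFun₂ (h.curvMatrix_eq hz j k) i l

theorem curv_antisymm {z : Coord n × Coord n} (hz : z ∈ U) (i l j k : Fin n) :
    hCurvComp F i l j k z = -hCurvComp F i l k j z := by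
  have h1 := congrFun₂ (h.curvMatrix_eq hz j k) i l
  have h2 := congrFun₂ (h.curvMatrix_eq hz k j) i l
  simp only [curvMatrix, Matrix.add_apply, Matrix.sub_apply, Matrix.of_apply] at h1 h2
  rw [h1, h2]; ring

/-- The first Bianchi identity. -/
theorem curv_cyclic {z : Coord n × Coord n} (hz : z ∈ U) (i l j k : Fin n) :
    hCurvComp F i l j k z + hCurvComp F i j k l z + hCurvComp F i k l j z = 0 := by
  have h1 := congrFun₂ (h.curvMatrix_eq hz j k) i l
  have h2 := congrFun₂ (h.curvMatrix_eq hz k l) i j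
  have h3 := congrFun₂ (h.curvMatrix_eq hz l j) i k
  simp only [curvMatrix, hDerivMatrix, connMatrix, Matrix.add_apply, Matrix.sub_apply,
    Matrix.mul_apply, Matrix.of_apply] at h1 h2 h3
  rw [h1, h2, h3, h.hDeriv_congr (fun w hw => h.hConn_symm hw i l j) hz k,
    h.hDeriv_congr (fun w hw => h.hConn_symm hw i l k) hz j,
    h.hDeriv_congr (fun w hw => h.hConn_symm hw i j k) hz l]
  simp only [h.hConn_symm hz _ l j, h.hConn_symm hz _ l k, h.hConn_symm hz _ j k]
  ring

/-- The second Bianchi identity, before the correction by the Christoffel symbols of the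
two-form indices. -/
theorem curvMatrix_bianchi {z : Coord n × Coord n} (hz : z ∈ U) (a b c : Fin n) :
    (hDerivMatrix F a (curvMatrix F b c) z + (connMatrix F a z * curvMatrix F b c z
        - curvMatrix F b c z * connMatrix F a z))
      + (hDerivMatrix F b (curvMatrix F c a) z + (connMatrix F b z * curvMatrix F c a z
        - curvMatrix F c a z * connMatrix F b z))
      + (hDerivMatrix F c (curvMatrix F a b) z + (connMatrix F c z * curvMatrix F a b z
        - curvMatrix F a b z * connMatrix F c z)) = 0 := by
  have dG : ∀ a i j, DifferentiableAt ℝ (fun w => connMatrix F a w i j) z :=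
    fun a i j => h.differentiableAt (h.contDiffOn_hConn i j a) hz
  have cD : ∀ a b i j, ContDiffOn ℝ ∞ (fun w => hDerivMatrix F a (connMatrix F b) w i j) U :=
    fun a b i j => h.contDiffOn_hDeriv a (h.contDiffOn_hConn i j b)
  have dD : ∀ a b i j, DifferentiableAt ℝ (fun w => hDerivMatrix F a (connMatrix F b) w i j) z :=
    fun a b i j => h.differentiableAt (cD a b i j) hz
  have cGG : ∀ a b i j, ContDiffOn ℝ ∞ (fun w => (connMatrix F a w * connMatrix F b w) i j) U :=
    fun a b => contDiffOn_matrix_mul (fun i j => h.contDiffOn_hConn i j a)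
      (fun i j => h.contDiffOn_hConn i j b)
  have dGG : ∀ a b i j,
      DifferentiableAt ℝ (fun w => (connMatrix F a w * connMatrix F b w) i j) z :=
    fun a b i j => h.differentiableAt (cGG a b i j) hz
  have comm : ∀ a b c, hDerivMatrix F a (hDerivMatrix F b (connMatrix F c)) z =
      hDerivMatrix F b (hDerivMatrix F a (connMatrix F c)) z := by
    intro a b c
    ext i j
    exact h.hDeriv_comm (h.contDiffOn_hConn i j c) hz a b
  have expand : ∀ a b c, hDerivMatrix F a (curvMatrix F b c) z =
      (hDerivMatrix F a (hDerivMatrix F c (connMatrix F b)) z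
        - hDerivMatrix F a (hDerivMatrix F b (connMatrix F c)) z)
      + ((hDerivMatrix F a (connMatrix F c) z * connMatrix F b z
        + connMatrix F c z * hDerivMatrix F a (connMatrix F b) z)
        - (hDerivMatrix F a (connMatrix F b) z * connMatrix F c z
        + connMatrix F b z * hDerivMatrix F a (connMatrix F c) z)) := by
    intro a b c
    rw [h.hDerivMatrix_congr (fun w hw => h.curvMatrix_eq hw b c) hz a,
      hDerivMatrix_add (B := fun w => hDerivMatrix F c (connMatrix F b) w
          - hDerivMatrix F b (connMatrix F c) w)
        (C := fun w => connMatrix F c w * connMatrix F b w - connMatrix F b w * connMatrix F c w)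
        (fun i j => (dD c b i j).sub (dD b c i j)) (fun i j => (dGG c b i j).sub (dGG b c i j)),
      hDerivMatrix_sub (dD _ _) (dD _ _), hDerivMatrix_sub (dGG _ _) (dGG _ _),
      hDerivMatrix_mul (dG _) (dG _), hDerivMatrix_mul (dG _) (dG _)]
  -- Once the second derivatives of `Γ` are put in a common order, what is left is the Jacobi
  -- identity and the Leibniz rule for noncommuting matrices.
  rw [expand, expand, expand, h.curvMatrix_eq hz, h.curvMatrix_eq hz, h.curvMatrix_eq hz,
    comm a c b, comm b a c, comm c b a]
  noncomm_ring

/-- `R(X, Y)` is skew with respect to the Finsler metric. -/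
theorem metric_mul_curvMatrix_skew {z : Coord n × Coord n} (hz : z ∈ U) (a b : Fin n) :
    metric F z * curvMatrix F a b z + (metric F z * curvMatrix F a b z).transpose = 0 := by
  have dG : ∀ a i j, DifferentiableAt ℝ (fun w => connMatrix F a w i j) z :=
    fun a i j => h.differentiableAt (h.contDiffOn_hConn i j a) hz
  have dg : ∀ i j, DifferentiableAt ℝ (fun w => metric F w i j) z :=
    fun i j => h.differentiableAt (h.contDiffOn_metric i j) hz
  have dgG : ∀ a i j, DifferentiableAt ℝ (fun w => (metric F w * connMatrix F a w) i j) z :=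
    fun a i j => h.differentiableAt (contDiffOn_matrix_mul h.contDiffOn_metric
      (fun i j => h.contDiffOn_hConn i j a) i j) hz
  have first : ∀ b, ∀ w ∈ U, hDerivMatrix F b (metric F) w =
      metric F w * connMatrix F b w + (metric F w * connMatrix F b w).transpose := by
    intro b w hw
    ext i j
    simp only [hDerivMatrix, Matrix.of_apply, Matrix.add_apply, Matrix.transpose_apply,
      Matrix.mul_apply, connMatrix]
    exact h.hDeriv_metric hw i j b
  have hsym : (metric F z).transpose = metric F z := by
    ext i j
    exact h.metric_symm hz j i
  have second : ∀ a b, hDerivMatrix F a (hDerivMatrix F b (metric F)) z =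
      ((metric F z * connMatrix F a z + (connMatrix F a z).transpose * metric F z)
        * connMatrix F b z + metric F z * hDerivMatrix F a (connMatrix F b) z)
      + ((metric F z * connMatrix F a z + (connMatrix F a z).transpose * metric F z)
        * connMatrix F b z + metric F z * hDerivMatrix F a (connMatrix F b) z).transpose := by
    intro a b
    rw [h.hDerivMatrix_congr (fun w hw => first b w hw) hz a,
      hDerivMatrix_add (C := fun w => (metric F w * connMatrix F b w).transpose) (dgG b)
        (fun i j => dgG b j i), hDerivMatrix_transpose,
      hDerivMatrix_mul dg (dG b), first a z hz, Matrix.transpose_mul, hsym]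
  have comm : hDerivMatrix F a (hDerivMatrix F b (metric F)) z =
      hDerivMatrix F b (hDerivMatrix F a (metric F)) z := by
    ext i j
    exact h.hDeriv_comm (h.contDiffOn_metric i j) hz a b
  -- Skewness is the integrability condition of `∇ʰg = 0`: the commutator of `δ_a` and `δ_b` on `g`
  -- is `-(gR + (gR)ᵀ)`, the terms `Γ_aᵀ g Γ_b` cancelling against transposes.
  rw [second, second, ← sub_eq_zero] at comm
  rw [h.curvMatrix_eq hz, ← neg_eq_zero, ← comm]
  simp only [Matrix.transpose_add, Matrix.transpose_sub, Matrix.transpose_mul,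
    Matrix.transpose_transpose, hsym]
  noncomm_ring

end IsIntegrableOn

end Curvature

/-! ### The Ricci identity and the second Bianchi identity -/

section Ricci

variable {n : ℕ} {F : Coord n × Coord n → ℝ} {U : Set (Coord n × Coord n)}

/-- The components of a `π`-tensor of type `(1, 3)` at a point. -/
def comps₄ (T : PiTensor n 1 3) (z : Coord n × Coord n) : Array₄ n :=
  fun i c d f => T ![i] ![c, d, f] z

theorem hCov_type_zero_one (T : PiTensor n 0 1) (a b : Fin n) (z : Coord n × Coord n) :
    hCov F T ![] ![a, b] z =
      hDeriv F a (T ![] ![b]) z - ∑ m, hConn F m b a z * T ![] ![m] z := by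
  have ht : Fin.tail ![a, b] = ![b] := rfl
  have h1 : ∀ m : Fin n, Function.update ![b] 0 m = ![m] := fun m => by
    ext i; fin_cases i; rfl
  simp only [hCov, ht, Fin.sum_univ_succ, Fin.sum_univ_zero]
  simp [h1]

theorem hCov_type_one_three (T : PiTensor n 1 3) (i a c d f : Fin n) (z : Coord n × Coord n) :
    hCov F T ![i] ![a, c, d, f] z = hDeriv F a (T ![i] ![c, d, f]) z +
      slotAction (connMatrix F a z) (comps₄ T z) i c d f := by
  have ht : Fin.tail ![a, c, d, f] = ![c, d, f] := rfl
  have h0 : ∀ m : Fin n, Function.update ![i] 0 m = ![m] := fun m => by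
    ext i; fin_cases i; rfl
  have h1 : ∀ m : Fin n, Function.update ![c, d, f] 0 m = ![m, d, f] := fun m => by
    ext i; fin_cases i <;> rfl
  have h2 : ∀ m : Fin n, Function.update ![c, d, f] 1 m = ![c, m, f] := fun m => by
    ext i; fin_cases i <;> rfl
  have h3 : ∀ m : Fin n, Function.update ![c, d, f] 2 m = ![c, d, m] := fun m => by
    ext i; fin_cases i <;> rfl
  simp only [hCov, ht, Fin.sum_univ_succ, Fin.sum_univ_zero]
  simp [h0, h1, h2, h3, slotAction, slot₁, slot₂, slot₃, slot₄, comps₄, connMatrix]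
  ring

/-- The index `b` of the earlier differentiation is kept apart from `slotAction`: its correction
term is symmetric in `a, b` when `S = ∇ʰT`, and so drops out of the Ricci identity. -/
theorem hCov_type_one_four (S : PiTensor n 1 4) (i a b c d f : Fin n) (z : Coord n × Coord n) :
    hCov F S ![i] ![a, b, c, d, f] z = hDeriv F a (S ![i] ![b, c, d, f]) z +
      slotAction (connMatrix F a z) (fun i c d f => S ![i] ![b, c, d, f] z) i c d f
      - ∑ m, hConn F m b a z * S ![i] ![m, c, d, f] z := by
  have ht : Fin.tail ![a, b, c, d, f] = ![b, c, d, f] := rfl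
  have h0 : ∀ m : Fin n, Function.update ![i] 0 m = ![m] := fun m => by
    ext i; fin_cases i; rfl
  have h1 : ∀ m : Fin n, Function.update ![b, c, d, f] 0 m = ![m, c, d, f] := fun m => by
    ext i; fin_cases i <;> rfl
  have h2 : ∀ m : Fin n, Function.update ![b, c, d, f] 1 m = ![b, m, d, f] := fun m => by
    ext i; fin_cases i <;> rfl
  have h3 : ∀ m : Fin n, Function.update ![b, c, d, f] 2 m = ![b, c, m, f] := fun m => by
    ext i; fin_cases i <;> rfl
  have h4 : ∀ m : Fin n, Function.update ![b, c, d, f] 3 m = ![b, c, d, m] := fun m => by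
    ext i; fin_cases i <;> rfl
  simp only [hCov, ht, Fin.sum_univ_succ, Fin.sum_univ_zero]
  simp [h0, h1, h2, h3, h4, slotAction, slot₁, slot₂, slot₃, slot₄, connMatrix]
  ring

theorem hDeriv_slotAction {B : Coord n × Coord n → Matrix (Fin n) (Fin n) ℝ}
    {T : Coord n × Coord n → Array₄ n} {z : Coord n × Coord n}
    (hB : ∀ i j, DifferentiableAt ℝ (fun w => B w i j) z)
    (hT : ∀ i c d f, DifferentiableAt ℝ (fun w => T w i c d f) z) (a i c d f : Fin n) :
    hDeriv F a (fun w => slotAction (B w) (T w) i c d f) z =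
      slotAction (hDerivMatrix F a B z) (T z) i c d f +
        slotAction (B z) (fun i c d f => hDeriv F a (fun w => T w i c d f) z) i c d f := by
  have dsum : ∀ {p q : Fin n → Coord n × Coord n → ℝ}, (∀ m, DifferentiableAt ℝ (p m) z) →
      (∀ m, DifferentiableAt ℝ (q m) z) →
      DifferentiableAt ℝ (fun w => ∑ m, p m w * q m w) z :=
    fun hp hq => DifferentiableAt.fun_sum fun m _ => (hp m).mul (hq m)
  have d1 := dsum (fun m => hB i m) (fun m => hT m c d f)
  have d2 := dsum (fun m => hB m c) (fun m => hT i m d f)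
  have d3 := dsum (fun m => hB m d) (fun m => hT i c m f)
  have d4 := dsum (fun m => hB m f) (fun m => hT i c d m)
  simp only [slotAction, slot₁, slot₂, slot₃, slot₄, Pi.sub_apply]
  rw [hDeriv_sub ((d1.fun_sub d2).fun_sub d3) d4, hDeriv_sub (d1.fun_sub d2) d3,
    hDeriv_sub d1 d2,
    hDeriv_sum_mul (fun m => hB i m) (fun m => hT m c d f),
    hDeriv_sum_mul (fun m => hB m c) (fun m => hT i m d f),
    hDeriv_sum_mul (fun m => hB m d) (fun m => hT i c m f),
    hDeriv_sum_mul (fun m => hB m f) (fun m => hT i c d m)]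
  simp only [hDerivMatrix, Matrix.of_apply]
  ring

namespace IsIntegrableOn

variable (h : IsIntegrableOn F U)
include h

theorem contDiffOn_hCov {T : PiTensor n 1 3}
    (hT : ∀ i c d f, ContDiffOn ℝ ∞ (T ![i] ![c, d, f]) U) (i a c d f : Fin n) :
    ContDiffOn ℝ ∞ (hCov F T ![i] ![a, c, d, f]) U := by
  have h1 : hCov F T ![i] ![a, c, d, f] = fun z => hDeriv F a (T ![i] ![c, d, f]) z +
      slotAction (connMatrix F a z) (comps₄ T z) i c d f :=
    funext fun z => hCov_type_one_three T i a c d f z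
  rw [h1]
  refine (h.contDiffOn_hDeriv a (hT i c d f)).add ?_
  simp only [slotAction, slot₁, slot₂, slot₃, slot₄, Pi.sub_apply]
  refine ((ContDiffOn.sub ?_ ?_).sub ?_).sub ?_ <;>
  exact ContDiffOn.sum fun m _ => (h.contDiffOn_hConn _ _ _).mul (hT _ _ _ _)

/-- The Ricci identity for tensors of type `(1, 3)`. -/
theorem hCov_hCov_sub {T : PiTensor n 1 3}
    (hT : ∀ i c d f, ContDiffOn ℝ ∞ (T ![i] ![c, d, f]) U) {z : Coord n × Coord n} (hz : z ∈ U)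
    (i a b c d f : Fin n) :
    hCov F (hCov F T) ![i] ![a, b, c, d, f] z - hCov F (hCov F T) ![i] ![b, a, c, d, f] z =
      -slotAction (curvMatrix F a b z) (comps₄ T z) i c d f := by
  have dG : ∀ a i j, DifferentiableAt ℝ (fun w => connMatrix F a w i j) z :=
    fun a i j => h.differentiableAt (h.contDiffOn_hConn i j a) hz
  have dT : ∀ i c d f, DifferentiableAt ℝ (fun w => comps₄ T w i c d f) z :=
    fun i c d f => h.differentiableAt (hT i c d f) hz
  have ds : ∀ a i c d f,
      DifferentiableAt ℝ (fun w => slotAction (connMatrix F a w) (comps₄ T w) i c d f) z := by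
    intro a i c d f
    -- The slot action is the difference between the covariant and the plain horizontal derivative,
    -- both known to be smooth.
    have := (h.differentiableAt (h.contDiffOn_hCov hT i a c d f) hz).sub
      (h.differentiableAt (h.contDiffOn_hDeriv a (hT i c d f)) hz)
    refine this.congr_of_eventuallyEq (Filter.Eventually.of_forall fun w => ?_)
    simp [hCov_type_one_three]
  have expand : ∀ a b, hCov F (hCov F T) ![i] ![a, b, c, d, f] z =
      (hDeriv F a (hDeriv F b (T ![i] ![c, d, f])) z
        + slotAction (hDerivMatrix F a (connMatrix F b) z) (comps₄ T z) i c d f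
        + slotAction (connMatrix F b z)
            (fun i c d f => hDeriv F a (T ![i] ![c, d, f]) z) i c d f)
      + (slotAction (connMatrix F a z)
            (fun i c d f => hDeriv F b (T ![i] ![c, d, f]) z) i c d f
        + slotAction (connMatrix F a z)
            (slotAction (connMatrix F b z) (comps₄ T z)) i c d f)
      - ∑ m, hConn F m b a z * hCov F T ![i] ![m, c, d, f] z := by
    intro a b
    have h1 : hCov F T ![i] ![b, c, d, f] = fun z => hDeriv F b (T ![i] ![c, d, f]) z +
        slotAction (connMatrix F b z) (comps₄ T z) i c d f :=
      funext fun z => hCov_type_one_three T i b c d f z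
    have h2 : (fun i c d f => hCov F T ![i] ![b, c, d, f] z) =
        (fun i c d f => hDeriv F b (T ![i] ![c, d, f]) z) +
        slotAction (connMatrix F b z) (comps₄ T z) := by
      funext i c d f
      exact hCov_type_one_three T i b c d f z
    have h3 : hDeriv F a (fun w => slotAction (connMatrix F b w) (comps₄ T w) i c d f) z =
        slotAction (hDerivMatrix F a (connMatrix F b) z) (comps₄ T z) i c d f +
          slotAction (connMatrix F b z)
            (fun i c d f => hDeriv F a (T ![i] ![c, d, f]) z) i c d f :=
      hDeriv_slotAction (dG b) dT a i c d f
    rw [hCov_type_one_four, h2, slotAction_add_right, h1,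
      hDeriv_add (h.differentiableAt (h.contDiffOn_hDeriv b (hT i c d f)) hz) (ds b i c d f),
      h3, Pi.add_apply, Pi.add_apply, Pi.add_apply, Pi.add_apply]
    ring!
  have key := congrFun (congrFun (congrFun₂
    (slotAction_commutator (connMatrix F a z) (connMatrix F b z) (comps₄ T z)) i c) d) f
  -- The terms with first derivatives of `T` are exchanged by `a ↔ b`; only derivatives of `Γ` and
  -- the commutator of `Γ_a, Γ_b` survive, which make up `-R(∂_a, ∂_b)`.
  rw [expand, expand, h.hDeriv_comm (hT i c d f) hz a b, h.curvMatrix_eq hz,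
    show hDerivMatrix F b (connMatrix F a) z - hDerivMatrix F a (connMatrix F b) z +
        (connMatrix F b z * connMatrix F a z - connMatrix F a z * connMatrix F b z) =
      hDerivMatrix F b (connMatrix F a) z - hDerivMatrix F a (connMatrix F b) z -
        (connMatrix F a z * connMatrix F b z - connMatrix F b z * connMatrix F a z) by abel,
    slotAction_sub_left _ _ (comps₄ T z), slotAction_sub_left _ _ (comps₄ T z)]
  simp only [Pi.sub_apply, key, h.hConn_symm hz _ b a]
  ring

/-- The second Bianchi identity for the h-curvature tensor. -/
theorem hCov_curv_cyclic {z : Coord n × Coord n} (hz : z ∈ U) (i a b c d : Fin n) :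
    hCov F (hCurv F) ![i] ![a, b, c, d] z + hCov F (hCurv F) ![i] ![b, c, a, d] z
      + hCov F (hCurv F) ![i] ![c, a, b, d] z = 0 := by
  have key := congrFun₂ (h.curvMatrix_bianchi hz a b c) i d
  -- Skewness brings both corrections to the form `R(∂_m, ·)`; in the cyclic sum they then cancel in
  -- pairs by the symmetry of `Γ`.
  have e : ∀ a b c : Fin n, hCov F (hCurv F) ![i] ![a, b, c, d] z =
      (hDerivMatrix F a (curvMatrix F b c) z + (connMatrix F a z * curvMatrix F b c z
        - curvMatrix F b c z * connMatrix F a z)) i d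
      - ∑ m, hConn F m b a z * hCurvComp F i d m c z
      + ∑ m, hConn F m c a z * hCurvComp F i d m b z := by
    intro a b c
    rw [hCov_type_one_three]
    simp only [slotAction, slot₁, slot₂, slot₃, slot₄, comps₄, connMatrix, hDerivMatrix,
      curvMatrix, Matrix.add_apply, Matrix.sub_apply, Matrix.mul_apply, Matrix.of_apply,
      Pi.sub_apply, mul_comm (hCurvComp F i _ b c z)]
    have h1 : ∀ m, hCurv F ![i] ![b, m, d] z = -hCurvComp F i d m b z :=
      fun m => h.curv_antisymm hz i d b m
    simp only [h1, mul_neg, Finset.sum_neg_distrib]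
    simp only [hCurv]
    simp
    ring
  simp only [Matrix.add_apply, Matrix.zero_apply] at key
  rw [e, e, e]
  simp only [h.hConn_symm hz _ b a, h.hConn_symm hz _ c a, h.hConn_symm hz _ c b]
  simp only [Matrix.add_apply]
  linarith

end IsIntegrableOn

end Ricci

/-! ### Walker's lemmas -/

section Walker

variable {n : ℕ} {F : Coord n × Coord n → ℝ} {U : Set (Coord n × Coord n)}

/-- The classical octahedron argument: a combination of the four cyclic identities obtained by
rotating `a, b, c, d`, simplified by skewness. -/
theorem pair_symm_of_cyclic {ι : Type*} {R : ι → ι → ι → ι → ℝ}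
    (h₁₂ : ∀ a b c d, R a b c d = -R b a c d) (h₃₄ : ∀ a b c d, R a b c d = -R a b d c)
    (hc : ∀ a b c d, R a b c d + R b c a d + R c a b d = 0) (a b c d : ι) :
    R a b c d = R c d a b := by
  linarith [hc a b c d, hc b c d a, hc c d a b, hc d a b c, h₁₂ a b c d, h₁₂ b c a d,
    h₁₂ c a b d, h₁₂ b c d a, h₁₂ c d b a, h₁₂ d b c a, h₁₂ c d a b, h₁₂ d a c b, h₁₂ a c d b,
    h₁₂ d a b c, h₁₂ a b d c, h₁₂ b d a c, h₃₄ a b c d, h₃₄ b c a d, h₃₄ c a b d, h₃₄ b c d a,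
    h₃₄ c d b a, h₃₄ d b c a, h₃₄ c d a b, h₃₄ d a c b, h₃₄ a c d b, h₃₄ d a b c, h₃₄ a b d c,
    h₃₄ b d a c]

/-- Walker's lemma: a nonzero symmetric array whose cyclic product with a vector vanishes. -/
theorem eq_zero_of_cyclic_mul {ι : Type*} {s : ι → ι → ℝ} {v : ι → ℝ}
    (hs : ∀ i j, s i j = s j i) (hc : ∀ i j k, v i * s j k + v j * s k i + v k * s i j = 0)
    (hne : ∃ i j, s i j ≠ 0) (k : ι) : v k = 0 := by
  by_contra hk
  obtain ⟨i, j, hij⟩ := hne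
  -- If `v k ≠ 0`, the relation at `(k, k, k)`, then `(k, k, l)`, then `(k, i, j)` kills `s k k`,
  -- the row `s k l`, and finally every `s i j`.
  have h1 : s k k = 0 := by
    have : v k * s k k = 0 := by linarith [hc k k k]
    exact (mul_eq_zero.1 this).resolve_left hk
  have h2 : ∀ l, s k l = 0 := by
    intro l
    have h3 := hc k k l
    rw [h1, hs l k] at h3
    have : v k * s k l = 0 := by linarith
    exact (mul_eq_zero.1 this).resolve_left hk
  have h3 := hc k i j
  rw [h2, hs j k, h2] at h3
  have : v k * s i j = 0 := by linarith
  exact hij ((mul_eq_zero.1 this).resolve_left hk)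

variable (F) in
/-- The components `𝐑(∂_a, ∂_b, ∂_c, ∂_d)`. -/
def lowComp (a b c d : Fin n) (z : Coord n × Coord n) : ℝ :=
  ∑ m, metric F z d m * hCurvComp F m c a b z

theorem hCurvAct_hCurvLow (j k : Fin n) (J : Fin 4 → Fin n)
    (z : Coord n × Coord n) (hsymm : ∀ i j, metric F z i j = metric F z j i) :
    hCurvAct F j k (hCurvLow F) ![] J z =
      -(∑ m, hCurvComp F m (J 0) j k z * lowComp F m (J 1) (J 2) (J 3) z
        + ∑ m, hCurvComp F m (J 1) j k z * lowComp F (J 0) m (J 2) (J 3) z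
        + ∑ m, hCurvComp F m (J 2) j k z * lowComp F (J 0) (J 1) m (J 3) z
        + ∑ m, hCurvComp F m (J 3) j k z * lowComp F (J 0) (J 1) (J 2) m z) := by
  have h1 : ∀ J : Fin 4 → Fin n, hCurvLow F ![] J z = lowComp F (J 0) (J 1) (J 2) (J 3) z :=
    fun J => Finset.sum_congr rfl fun m _ => by rw [hsymm]
  simp only [hCurvAct, h1, Fin.sum_univ_four]
  simp

namespace IsIntegrableOn

variable (h : IsIntegrableOn F U)
include h

theorem lowComp_antisymm_left {z : Coord n × Coord n} (hz : z ∈ U) (a b c d : Fin n) :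
    lowComp F a b c d z = -lowComp F b a c d z := by
  simp only [lowComp, h.curv_antisymm hz _ _ a b, mul_neg, Finset.sum_neg_distrib]

theorem lowComp_antisymm_right {z : Coord n × Coord n} (hz : z ∈ U) (a b c d : Fin n) :
    lowComp F a b c d z = -lowComp F a b d c z := by
  have h1 := congrFun₂ (h.metric_mul_curvMatrix_skew hz a b) c d
  simp only [Matrix.add_apply, Matrix.transpose_apply, Matrix.mul_apply, curvMatrix,
    Matrix.of_apply, Matrix.zero_apply] at h1
  simp only [lowComp]
  linarith

theorem lowComp_cyclic {z : Coord n × Coord n} (hz : z ∈ U) (a b c d : Fin n) :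
    lowComp F a b c d z + lowComp F b c a d z + lowComp F c a b d z = 0 := by
  simp only [lowComp, ← Finset.sum_add_distrib, ← mul_add]
  refine Finset.sum_eq_zero fun m _ => ?_
  have := h.curv_cyclic hz m c a b
  rw [show hCurvComp F m c a b z + hCurvComp F m a b c z + hCurvComp F m b c a z = 0 by
    linarith, mul_zero]

theorem lowComp_pair_symm {z : Coord n × Coord n} (hz : z ∈ U) (a b c d : Fin n) :
    lowComp F a b c d z = lowComp F c d a b z :=
  pair_symm_of_cyclic (R := fun a b c d => lowComp F a b c d z) (h.lowComp_antisymm_left hz)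
    (h.lowComp_antisymm_right hz) (h.lowComp_cyclic hz) a b c d

theorem curv_eq_sum_lowComp {z : Coord n × Coord n} (hz : z ∈ U) (m c a b : Fin n) :
    hCurvComp F m c a b z = ∑ p, (metric F z)⁻¹ m p * lowComp F a b c p z := by
  have h1 : (metric F z)⁻¹ * (metric F z * curvMatrix F a b z) = curvMatrix F a b z := by
    rw [← Matrix.mul_assoc, Matrix.nonsing_inv_mul _
      (isUnit_iff_ne_zero.2 (h.det_metric_ne_zero hz)), Matrix.one_mul]
  have h2 := congrFun₂ h1 m c
  rw [Matrix.mul_apply] at h2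
  simp only [Matrix.mul_apply (M := metric F z), curvMatrix, Matrix.of_apply] at h2
  exact h2.symm

/-- Walker's identity: the cyclic sum of `R(X, Y)𝐑` over three pairs of arguments vanishes. -/
theorem hCurvAct_cyclic {z : Coord n × Coord n} (hz : z ∈ U) (a b c d e f : Fin n) :
    hCurvAct F a b (hCurvLow F) ![] ![c, d, e, f] z
      + hCurvAct F c d (hCurvLow F) ![] ![e, f, a, b] z
      + hCurvAct F e f (hCurvLow F) ![] ![a, b, c, d] z = 0 := by
  -- `P` contracts two copies of `𝐑` in their last slots, so it is symmetric under exchange of its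
  -- two triples. The cyclic sum consists of twelve such terms, which cancel in six pairs.
  let P : Fin n → Fin n → Fin n → Fin n → Fin n → Fin n → ℝ := fun a b c d e f =>
    ∑ m, ∑ p, (metric F z)⁻¹ m p * lowComp F a b c p z * lowComp F d e f m z
  have hP : ∀ a b c d e f, P a b c d e f = P d e f a b c := by
    intro a b c d e f
    simp only [P]
    rw [Finset.sum_comm]
    refine Finset.sum_congr rfl fun p _ => Finset.sum_congr rfl fun m _ => ?_
    rw [h.metric_inv_symm hz m p]
    ring
  have hsum : ∀ a b c d e f, ∑ m, hCurvComp F m c a b z * lowComp F d e f m z =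
      P a b c d e f := by
    intro a b c d e f
    simp only [P, h.curv_eq_sum_lowComp hz, Finset.sum_mul]
  have act : ∀ a b c d e f, hCurvAct F a b (hCurvLow F) ![] ![c, d, e, f] z =
      P a b c e f d - P a b d e f c + P a b e c d f - P a b f c d e := by
    intro a b c d e f
    rw [hCurvAct_hCurvLow _ _ _ _ (h.metric_symm hz)]
    simp only [Matrix.cons_val]
    have e1 : ∀ m, lowComp F m d e f z = -lowComp F e f d m z := fun m => by
      rw [h.lowComp_pair_symm hz, h.lowComp_antisymm_right hz]
    have e2 : ∀ m, lowComp F c m e f z = lowComp F e f c m z := fun m => by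
      rw [h.lowComp_pair_symm hz]
    have e3 : ∀ m, lowComp F c d m f z = -lowComp F c d f m z := fun m => by
      rw [h.lowComp_antisymm_right hz]
    simp only [e1, e2, e3, mul_neg, Finset.sum_neg_distrib, hsum]
    ring
  rw [act, act, act, hP e f a c d b, hP e f b c d a, hP e f c a b d, hP e f d a b c,
    hP c d a e f b]
  linarith [hP a b e c d f, hP a b f c d e, hP c d b e f a]

end IsIntegrableOn

end Walker

/-! ### Recurrence conditions in induced coordinates -/

section Recurrence

variable {n : ℕ} {F : Coord n × Coord n → ℝ} {U : Set (Coord n × Coord n)}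

namespace IsIntegrableOn

variable (h : IsIntegrableOn F U)
include h

/-- If the antisymmetrized second covariant derivative of `R` is a multiple of `R`, then so is
`R(X, Y)𝐑`. -/
theorem mul_lowComp_eq {z : Coord n × Coord n} (hz : z ∈ U) {a b : Fin n} {t : ℝ}
    (ht : ∀ i c d f, t * hCurvComp F i f c d z =
      -slotAction (curvMatrix F a b z) (comps₄ (hCurv F) z) i c d f) (c d f e : Fin n) :
    t * lowComp F c d f e z = -hCurvAct F a b (hCurvLow F) ![] ![c, d, f, e] z := by
  have h1 : t * lowComp F c d f e z = ∑ i, metric F z e i * (t * hCurvComp F i f c d z) := by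
    rw [lowComp, Finset.mul_sum]
    exact Finset.sum_congr rfl fun m _ => by ring
  have swap : ∀ (p : Fin n → ℝ) (q : Fin n → Fin n → ℝ),
      ∑ i, metric F z e i * ∑ m, p m * q m i = ∑ m, p m * ∑ i, metric F z e i * q m i := by
    intro p q
    simp only [Finset.mul_sum]
    rw [Finset.sum_comm]
    exact Finset.sum_congr rfl fun m _ => Finset.sum_congr rfl fun i _ => by ring
  -- Skewness of `R(∂_a, ∂_b)` turns the action on the contravariant index into the action on the
  -- lowered one, sign included.
  have h2 : ∑ i, metric F z e i * ∑ m, hCurvComp F i m a b z * hCurvComp F m f c d z =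
      -∑ m, hCurvComp F m e a b z * lowComp F c d f m z := by
    have h3 : ∑ i, metric F z e i * ∑ m, hCurvComp F i m a b z * hCurvComp F m f c d z =
        ∑ m, lowComp F a b m e z * hCurvComp F m f c d z := by
      simp only [lowComp, Finset.mul_sum, Finset.sum_mul]
      rw [Finset.sum_comm]
      exact Finset.sum_congr rfl fun m _ => Finset.sum_congr rfl fun i _ => by ring
    rw [h3]
    simp only [h.lowComp_antisymm_right hz a b _ e, neg_mul, Finset.sum_neg_distrib]
    simp only [lowComp, Finset.mul_sum, Finset.sum_mul]
    rw [Finset.sum_comm]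
    congr 1
    refine Finset.sum_congr rfl fun m _ => Finset.sum_congr rfl fun i _ => ?_
    rw [h.metric_symm hz i m]
    ring
  rw [h1, hCurvAct_hCurvLow _ _ _ _ (h.metric_symm hz)]
  simp only [ht, slotAction, slot₁, slot₂, slot₃, slot₄, Pi.sub_apply, comps₄, hCurv, curvMatrix,
    Matrix.of_apply, Matrix.cons_val, mul_neg, mul_sub, Finset.sum_neg_distrib,
    Finset.sum_sub_distrib, h2]
  rw [swap, swap, swap]
  simp only [lowComp]
  ring

theorem exists_lowComp_ne_zero {z : Coord n × Coord n} (hz : z ∈ U)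
    (hne : ∃ I J, hCurv F I J z ≠ 0) : ∃ a b c d, lowComp F a b c d z ≠ 0 := by
  by_contra! hall
  obtain ⟨I, J, hIJ⟩ := hne
  refine hIJ ?_
  rw [hCurv, h.curv_eq_sum_lowComp hz]
  simp [hall]

/-- A skew array of factors of proportionality between `R(X, Y)·R` and `R` vanishes where `R`
does not. -/
theorem factor_eq_zero {z : Coord n × Coord n} (hz : z ∈ U) {t : Fin n → Fin n → ℝ}
    (ht : ∀ i a b c d f, t a b * hCurvComp F i f c d z =
      -slotAction (curvMatrix F a b z) (comps₄ (hCurv F) z) i c d f)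
    (hne : ∃ I J, hCurv F I J z ≠ 0) (a b : Fin n) : t a b = 0 := by
  obtain ⟨p, q, r, s, hpq⟩ := h.exists_lowComp_ne_zero hz hne
  -- Walker's lemma is applied with pairs of indices as indices: pair symmetry makes `𝐑` a symmetric
  -- array.
  refine eq_zero_of_cyclic_mul (ι := Fin n × Fin n) (v := fun i => t i.1 i.2)
    (s := fun i j => lowComp F i.1 i.2 j.1 j.2 z)
    (fun i j => h.lowComp_pair_symm hz _ _ _ _) (fun i j k => ?_) ⟨(p, q), (r, s), hpq⟩ (a, b)
  simp only [h.mul_lowComp_eq hz fun i' c d f => ht i' _ _ c d f]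
  linarith [h.hCurvAct_cyclic hz i.1 i.2 j.1 j.2 k.1 k.2]

/-- A pointwise dichotomy, without density: if `R ≠ 0` at `z` the factor vanishes, and if `R = 0` at
`z` the action is zero. -/
theorem hCurvAct_eq_zero {z : Coord n × Coord n} (hz : z ∈ U) {t : Fin n → Fin n → ℝ}
    (ht : ∀ i a b c d f, t a b * hCurvComp F i f c d z =
      -slotAction (curvMatrix F a b z) (comps₄ (hCurv F) z) i c d f)
    (j k : Fin n) (J : Fin 4 → Fin n) : hCurvAct F j k (hCurvLow F) ![] J z = 0 := by
  have hJ : J = ![J 0, J 1, J 2, J 3] := by ext i; fin_cases i <;> rfl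
  have key := h.mul_lowComp_eq hz (fun i c d f => ht i j k c d f) (J 0) (J 1) (J 2) (J 3)
  rw [← hJ] at key
  by_cases hne : ∃ I J, hCurv F I J z ≠ 0
  · rw [h.factor_eq_zero hz ht hne j k, zero_mul] at key
    linarith
  · push Not at hne
    have h0 : ∀ m c a b, hCurvComp F m c a b z = 0 := fun m c a b => hne ![m] ![a, b, c]
    simp [hCurvAct, h0]

theorem contDiffOn_hCov_one {A : PiTensor n 0 1} (hA : ∀ I J, ContDiffOn ℝ ∞ (A I J) U)
    (a b : Fin n) : ContDiffOn ℝ ∞ (hCov F A ![] ![a, b]) U := by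
  rw [show hCov F A ![] ![a, b] = fun z => _ from funext (hCov_type_zero_one A a b)]
  exact (h.contDiffOn_hDeriv a (hA _ _)).sub
    (ContDiffOn.sum fun m _ => (h.contDiffOn_hConn _ _ _).mul (hA _ _))

/-- The second covariant derivative of a recurrent tensor. -/
theorem hCov_hCov_of_recurrent {T : PiTensor n 1 3} {A : PiTensor n 0 1}
    (hT : ∀ i c d f, ContDiffOn ℝ ∞ (T ![i] ![c, d, f]) U)
    (hA : ∀ I J, ContDiffOn ℝ ∞ (A I J) U)
    (hrec : ∀ z ∈ U, ∀ i a b c d : Fin n, hCov F T ![i] ![a, b, c, d] z =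
      A ![] ![a] z * T ![i] ![b, c, d] z)
    {z : Coord n × Coord n} (hz : z ∈ U) (i a b c d f : Fin n) :
    hCov F (hCov F T) ![i] ![a, b, c, d, f] z =
      (hCov F A ![] ![a, b] z + A ![] ![a] z * A ![] ![b] z) * T ![i] ![c, d, f] z := by
  have h1 : hDeriv F a (hCov F T ![i] ![b, c, d, f]) z =
      hDeriv F a (A ![] ![b]) z * T ![i] ![c, d, f] z
        + A ![] ![b] z * hDeriv F a (T ![i] ![c, d, f]) z := by
    rw [h.hDeriv_congr (fun w hw => hrec w hw i b c d f) hz a,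
      hDeriv_mul (h.differentiableAt (hA _ _) hz) (h.differentiableAt (hT _ _ _ _) hz)]
  have h2 := hrec z hz i a c d f
  rw [hCov_type_one_three] at h2
  rw [hCov_type_one_four, h1, hCov_type_zero_one]
  simp only [hrec z hz, slotAction, slot₁, slot₂, slot₃, slot₄, Pi.sub_apply, comps₄,
    mul_left_comm _ (A ![] ![b] z) _, ← Finset.mul_sum] at h2 ⊢
  simp only [← mul_assoc, ← Finset.sum_mul] at h2 ⊢
  -- The derivative falling on `T` is replaced by recurrence times `A_b`; `δ_a A_b` and the `Γ` term
  -- of the index `b` combine to `∇ʰA`.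
  linear_combination A ![] ![b] z * h2

theorem factor_of_hCov_hCov {z : Coord n × Coord n} (hz : z ∈ U) {α : Fin n → Fin n → ℝ}
    (hα : ∀ i a b c d f, hCov F (hCov F (hCurv F)) ![i] ![a, b, c, d, f] z =
      α a b * hCurv F ![i] ![c, d, f] z) (i a b c d f : Fin n) :
    (α a b - α b a) * hCurvComp F i f c d z =
      -slotAction (curvMatrix F a b z) (comps₄ (hCurv F) z) i c d f := by
  rw [← h.hCov_hCov_sub (fun i c d f => h.contDiffOn_curv i f c d) hz, hα, hα]
  exact sub_mul _ _ _

end IsIntegrableOn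

end Recurrence

/-! ### Charts -/

section Charts

variable {n : ℕ} {M : Type*} [TopologicalSpace M]

theorem isOpen_chartDomain (e : OpenPartialHomeomorph M (Coord n)) : IsOpen (chartDomain e) :=
  (e.open_target.preimage continuous_fst).inter (isOpen_ne.preimage continuous_snd)

/-- Horizontal and vertical spaces meet in zero, since the position part of `δ_i` is the basis
vector `basisVec i`. -/
theorem eq_zero_of_mem_span_hFrame {F : Coord n × Coord n → ℝ} {z v : Coord n × Coord n}
    (hv : v ∈ Submodule.span ℝ (Set.range fun i => hFrame F i z)) (h1 : v.1 = 0) : v = 0 := by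
  obtain ⟨t, rfl⟩ := (Submodule.mem_span_range_iff_exists_fun ℝ).1 hv
  have ht : ∀ j, t j = 0 := by
    intro j
    have := congrArg (fun w : Coord n => w j) h1
    simpa [hFrame, Prod.fst_sum, Finset.sum_apply, Pi.single_apply] using this
  simp [ht]

variable [ChartedSpace (Coord n) M]

theorem FinslerMetric.isIntegrableOn (L : FinslerMetric n M) (hL : L.HorizontallyIntegrable)
    {e : OpenPartialHomeomorph M (Coord n)} (he : e ∈ atlas (Coord n) M) :
    IsIntegrableOn (L.inChart e) (chartDomain e) where
  isOpen := isOpen_chartDomain e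
  smooth := L.smooth e he
  posDef := L.posDef e he
  lieBracket_eq_zero z hz j k := by
    refine eq_zero_of_mem_span_hFrame (hL e he z hz j k) ?_
    have hfst : ∀ (j : Fin n) (v : Coord n × Coord n),
        (fderiv ℝ (hFrame (L.inChart e) j) z v).1 = 0 := by
      intro j v
      -- The position part of the frame is constant. Smoothness of the frame is not yet available
      -- here; in the other case `fderiv` takes its default value zero.
      by_cases hd : DifferentiableAt ℝ (hFrame (L.inChart e) j) z
      · have h1 := hd.hasFDerivAt.fst.fderiv
        have h2 : (fun w => (hFrame (L.inChart e) j w).1) = fun _ => basisVec j := rfl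
        rw [h2, fderiv_fun_const] at h1
        exact (congrArg (fun l => l v) h1).symm
      · simp [fderiv_zero_of_not_differentiableAt hd]
    simp [VectorField.lieBracket, hfst]

/-- Continuity and density of the set where `R ≠ 0`. -/
theorem FinslerMetric.eqOn_zero_of_curv_ne_zero (L : FinslerMetric n M) (hR : L.CurvatureNonzero)
    {e : OpenPartialHomeomorph M (Coord n)} (he : e ∈ atlas (Coord n) M)
    {φ : Coord n × Coord n → ℝ} (hφ : ContDiffOn ℝ ∞ φ (chartDomain e))
    (h0 : ∀ z ∈ chartDomain e, (∃ I J, hCurv (L.inChart e) I J z ≠ 0) → φ z = 0)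
    {z : Coord n × Coord n} (hz : z ∈ chartDomain e) : φ z = 0 :=
  Set.EqOn.of_subset_closure (g := fun _ => (0 : ℝ))
    (s := {z ∈ chartDomain e | ∃ I J, hCurv (L.inChart e) I J z ≠ 0})
    (fun w hw => h0 w hw.1 hw.2) hφ.continuousOn continuousOn_const (Set.sep_subset _ _)
    (hR e he) hz

variable [IsManifold (𝓡 n) ∞ M]

theorem surjective_chartVec {e : OpenPartialHomeomorph M (Coord n)} (he : e ∈ atlas (Coord n) M)
    {x : Coord n} (hx : x ∈ e.target) : Function.Surjective (chartVec e x) := by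
  have : IsManifold (𝓡 n) 1 M := IsManifold.of_le (n := ∞) (by simp)
  exact (mdifferentiable_of_mem_atlas (I := 𝓡 n) he).symm.mfderiv_surjective hx

theorem exists_chartPoint_eq (p : M) (v : TangentSpace (𝓡 n) p) (hv : v ≠ 0) :
    ∃ e ∈ atlas (Coord n) M, ∃ z ∈ chartDomain e,
      chartPoint e z = (⟨p, v⟩ : TangentBundle (𝓡 n) M) := by
  obtain ⟨e, he, x, hx, rfl⟩ :
      ∃ e ∈ atlas (Coord n) M, ∃ x ∈ e.target, e.symm x = p :=
    ⟨chartAt (Coord n) p, chart_mem_atlas _ p, _, mem_chart_target _ p,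
      (chartAt (Coord n) p).left_inv (mem_chart_source _ p)⟩
  obtain ⟨y, rfl⟩ := surjective_chartVec he hx v
  refine ⟨e, he, (x, y), ⟨hx, fun hy => hv ?_⟩, rfl⟩
  have hy' : y = 0 := hy
  rw [hy']
  exact map_zero (mfderiv (𝓡 n) (𝓡 n) e.symm x)

/-- A bilinear form is determined by its values on a basis, and the chart identifies the tangent
space with `ℝⁿ`. -/
theorem ScalarForm.symm_of_inChart (α : ScalarForm n M 2)
    {e : OpenPartialHomeomorph M (Coord n)} (he : e ∈ atlas (Coord n) M)
    {z : Coord n × Coord n} (hz : z ∈ chartDomain e)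
    (hα : ∀ a b, α.inChart e ![] ![a, b] z = α.inChart e ![] ![b, a] z)
    (X Y : TangentSpace (𝓡 n) (chartPoint e z).proj) :
    α (chartPoint e z) ![X, Y] = α (chartPoint e z) ![Y, X] := by
  let D : Coord n →ₗ[ℝ] TangentSpace (𝓡 n) (chartPoint e z).proj :=
    (mfderiv (𝓡 n) (𝓡 n) e.symm z.1).toLinearMap
  let β : MultilinearMap ℝ (fun _ : Fin 2 => Coord n) ℝ :=
    (α (chartPoint e z)).compLinearMap fun _ => D
  have hβ : β = β.domDomCongr (Equiv.swap 0 1) := by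
    refine Module.Basis.ext_multilinear (fun _ => (EuclideanSpace.basisFun (Fin n) ℝ).toBasis)
      fun v => ?_
    have h1 := hα (v 0) (v 1)
    have h2 : ∀ a b : Fin n, α.inChart e ![] ![a, b] z = β ![basisVec a, basisVec b] := by
      intro a b
      refine congrArg (α (chartPoint e z)) (funext fun i => ?_)
      fin_cases i <;> rfl
    rw [h2, h2] at h1
    have h3 : (fun i => (EuclideanSpace.basisFun (Fin n) ℝ).toBasis (v i)) =
        ![basisVec (v 0), basisVec (v 1)] := by
      funext i
      fin_cases i <;> simp
    rw [h3, h1, MultilinearMap.domDomCongr_apply]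
    refine congrArg β (funext fun i => ?_)
    fin_cases i <;> simp
  obtain ⟨x, rfl⟩ := surjective_chartVec he hz.1 X
  obtain ⟨y, rfl⟩ := surjective_chartVec he hz.1 Y
  have h1 : ∀ x y : Coord n, β ![x, y] =
      α (chartPoint e z) ![chartVec e z.1 x, chartVec e z.1 y] := by
    intro x y
    refine congrArg (α (chartPoint e z)) (funext fun i => ?_)
    fin_cases i <;> rfl
  have h2 : β.domDomCongr (Equiv.swap 0 1) ![x, y] = β ![y, x] := by
    rw [MultilinearMap.domDomCongr_apply]
    refine congrArg β (funext fun i => ?_)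
    fin_cases i <;> simp
  rw [← hβ] at h2
  exact (h1 x y).symm.trans (h2.trans (h1 y x))

end Charts
end Finsler

end

/-! ### The theorem on recurrent and 2-recurrent Finsler manifolds -/

theorem mainTheorem9 {n : ℕ} (hn : 3 ≤ n) {M : Type*} [TopologicalSpace M]
    [ChartedSpace (EuclideanSpace ℝ (Fin n)) M] [IsManifold (𝓡 n) ∞ M]
    (L : Finsler.FinslerMetric n M) (hL : L.HorizontallyIntegrable) :
    (∀ A : Finsler.ScalarForm n M 1, L.IsRecurrent A →
      (∀ e ∈ atlas (EuclideanSpace ℝ (Fin n)) M, ∀ z ∈ Finsler.chartDomain e,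
        ∀ i a b c d : Fin n,
          A.inChart e ![] ![a] z * Finsler.hCurv (L.inChart e) ![i] ![b, c, d] z
            + A.inChart e ![] ![b] z * Finsler.hCurv (L.inChart e) ![i] ![c, a, d] z
            + A.inChart e ![] ![c] z * Finsler.hCurv (L.inChart e) ![i] ![a, b, d] z = 0) ∧
      (∀ e ∈ atlas (EuclideanSpace ℝ (Fin n)) M, ∀ z ∈ Finsler.chartDomain e,
        ∀ a b : Fin n,
          Finsler.hCov (L.inChart e) (A.inChart e) ![] ![a, b] z =
            Finsler.hCov (L.inChart e) (A.inChart e) ![] ![b, a] z) ∧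
      L.CurvatureSemisymmetric) ∧
    (∀ α : Finsler.ScalarForm n M 2, L.IsTwoRecurrent α →
      (∀ (p : M) (v : TangentSpace (𝓡 n) p), v ≠ 0 → ∀ X Y : TangentSpace (𝓡 n) p,
        α ⟨p, v⟩ ![X, Y] = α ⟨p, v⟩ ![Y, X]) ∧
      L.CurvatureSemisymmetric) := by
  refine ⟨fun A hA => ?_, fun α hα => ?_⟩
  -- `A ⊗ A` is symmetric, so this factor is the antisymmetrization of `∇ʰA` alone.
  · have factor : ∀ e ∈ atlas (EuclideanSpace ℝ (Fin n)) M, ∀ z ∈ Finsler.chartDomain e,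
        ∀ i a b c d f : Fin n,
        ((Finsler.hCov (L.inChart e) (A.inChart e) ![] ![a, b] z
            + A.inChart e ![] ![a] z * A.inChart e ![] ![b] z)
          - (Finsler.hCov (L.inChart e) (A.inChart e) ![] ![b, a] z
            + A.inChart e ![] ![b] z * A.inChart e ![] ![a] z))
          * Finsler.hCurvComp (L.inChart e) i f c d z =
        -Finsler.slotAction (Finsler.curvMatrix (L.inChart e) a b z)
          (Finsler.comps₄ (Finsler.hCurv (L.inChart e)) z) i c d f := by
      intro e he z hz
      have h := L.isIntegrableOn hL he
      exact h.factor_of_hCov_hCov hz (h.hCov_hCov_of_recurrent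
        (fun i c d f => h.contDiffOn_curv i f c d) (hA.form.smooth e he)
        (hA.recurrence e he) hz)
    refine ⟨fun e he z hz i a b c d => ?_, fun e he z hz a b => ?_, fun e he z hz j k J => ?_⟩
    · have h := L.isIntegrableOn hL he
      rw [← hA.recurrence e he z hz, ← hA.recurrence e he z hz, ← hA.recurrence e he z hz]
      exact h.hCov_curv_cyclic hz i a b c d
    · have h := L.isIntegrableOn hL he
      refine sub_eq_zero.1 (L.eqOn_zero_of_curv_ne_zero hA.curvature_nonzero he
        ((h.contDiffOn_hCov_one (hA.form.smooth e he) a b).sub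
          (h.contDiffOn_hCov_one (hA.form.smooth e he) b a)) (fun w hw hne => ?_) hz)
      have := h.factor_eq_zero hw (factor e he w hw) hne a b
      linarith
    · exact (L.isIntegrableOn hL he).hCurvAct_eq_zero hz (factor e he z hz) j k J
  · have factor := fun e he z hz => (L.isIntegrableOn hL he).factor_of_hCov_hCov hz
      (hα.recurrence e he z hz)
    refine ⟨fun p v hv => ?_, fun e he z hz j k J => ?_⟩
    · obtain ⟨e, he, z, hz, hpv⟩ := Finsler.exists_chartPoint_eq p v hv
      have hsymm := α.symm_of_inChart he hz fun a b => sub_eq_zero.1 <|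
        L.eqOn_zero_of_curv_ne_zero hα.curvature_nonzero he
          ((hα.form.smooth e he _ _).sub (hα.form.smooth e he _ _))
          (fun w hw hne => (L.isIntegrableOn hL he).factor_eq_zero hw (factor e he w hw) hne a b)
          hz
      rw [hpv] at hsymm
      exact hsymm
    · exact (L.isIntegrableOn hL he).hCurvAct_eq_zero hz (factor e he z hz) j k J
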